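/- **Proposition 3.1.** Let $n\ge 2$ be an integer. An ai-semiring is a non-empty algebra $(S,+,\cdot)$ in which $(S,+)$ is a commutative idempotent semigroup, $(S,\cdot)$ is a semigroup, and $\cdot$ distributes over $+$ on both sides. Let $\mathbf{Sr}(n,1)$ be the variety of ai-semirings defined by the identity $x^n\approx x$. For $k\ge 2$ let $\mathbf{M}_k$ be the subvariety of $\mathbf{Sr}(k,1)$ defined by the additional identity $x^{k-1}+y^{k-1}\approx x^{k-1}y^{k-1}$. Let $\mathcal{L}(\mathbf{Sr}(n,1))$ be the lattice (under inclusion) of subvarieties of $\mathbf{Sr}(n,1)$, and let $[\mathbf{M}_2,\mathbf{M}_n]$ be the interval of all ai-semiring varieties $\mathbf{W}$ with $\mathbf{M}_2\subseteq\mathbf{W}\subseteq\mathbf{M}_n$, with its lattice structure inherited from the lattice of ai-semiring varieties. Let $\mathbf{G}(n,1)$ be the variety of all groups satisfying $x^n\approx x$, and let $\mathcal{L}_q(\mathbf{G}(n,1))$ be the lattice (under inclusion) of subquasivarieties of $\mathbf{G}(n,1)$, that is, of the subclasses of $\mathbf{G}(n,1)$ defined by sets of quasi-identities. For a group $G$ let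 $G^0$ denote its flat extension: the ai-semiring on $G\cup\{0\}$ in which the multiplication extends that of $G$ with $0$ a multiplicative zero, and $a+b=a$ if $a=b$, $a+b=0$ if $a\neq b$. For a class $\mathcal{A}$ of ai-semirings let $\mathbf{HSP}(\mathcal{A})$ be the class of all homomorphic images of subalgebras of direct products of members of $\mathcal{A}$, i.e. the variety generated by $\mathcal{A}$. Then for every $\mathcal{V}\in\mathcal{L}_q(\mathbf{G}(n,1))$ the class $\mathbf{HSP}(\{G^0\mid G\in\mathcal{V}\})$ is a variety belonging to $[\mathbf{M}_2,\mathbf{M}_n]$, and the map $$\psi:\mathcal{L}_q(\mathbf{G}(n,1))\to[\mathbf{M}_2,\mathbf{M}_n],\qquad \mathcal{V}\mapsto\mathbf{HSP}(\{G^0\mid G\in\mathcal{V}\}),$$ is a lattice isomorphism. Consequently, there is an injective lattice homomorphism $\mathcal{L}_q(\mathbf{G}(n,1))\to\mathcal{L}(\mathbf{Sr}(n,1))$. -/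

import Mathlib

universe u

namespace BurnsideAI

/-! ## Ai-semirings -/

/-- An additively idempotent semiring: `(S, +)` is a semilattice, `(S, *)` is a semigroup, and
multiplication distributes over addition on both sides. No zero or one is required. -/
class AISemiring (S : Type u) extends AddCommSemigroup S, Semigroup S, Distrib S where
  add_idem : ∀ a : S, a + a = a

/-- Bundled ai-semirings (with non-empty carrier, as usual in universal algebra). -/
structure AISr : Type (u + 1) where
  carrier : Type u
  [str : AISemiring carrier]
  [nonempty : Nonempty carrier]

instance : CoeSort AISr.{u} (Type u) := ⟨AISr.carrier⟩

instance (A : AISr.{u}) : AISemiring A := A.str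

instance (A : AISr.{u}) : Nonempty A := A.nonempty

/-- `f` is a homomorphism of algebras of type `(2, 2)`. -/
def IsHom {A B : Type u} [AISemiring A] [AISemiring B] (f : A → B) : Prop :=
  (∀ x y, f (x + y) = f x + f y) ∧ ∀ x y, f (x * y) = f x * f y

/-! ## Identities and varieties of ai-semirings -/

/-- Terms in the operations `+`, `*` over the countably infinite set `ℕ` of variables. -/
inductive Term : Type
  | var : ℕ → Term
  | add : Term → Term → Term
  | mul : Term → Term → Term

/-- Powers `t ^ k` of a term, for `k ≥ 1` (the value at `k = 0` is a dummy, never used). -/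
def Term.pow (t : Term) : ℕ → Term
  | 0 => t
  | 1 => t
  | k + 2 => Term.mul (Term.pow t (k + 1)) t

/-- The value of a term in `S` under an assignment of the variables. -/
def Term.eval {S : Type u} [AISemiring S] (f : ℕ → S) : Term → S
  | .var i => f i
  | .add s t => Term.eval f s + Term.eval f t
  | .mul s t => Term.eval f s * Term.eval f t

/-- `S` satisfies the identity `e.1 ≈ e.2`. -/
def SatisfiesId (S : Type u) [AISemiring S] (e : Term × Term) : Prop :=
  ∀ f : ℕ → S, e.1.eval f = e.2.eval f

/-- The class of all ai-semirings satisfying all the identities in `E`. -/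
def modelsId (E : Set (Term × Term)) : Set AISr.{u} :=
  {S | ∀ e ∈ E, SatisfiesId S e}

/-- Varieties of ai-semirings: the classes of ai-semirings defined by a set of identities. -/
@[ext]
structure AIVariety : Type (u + 1) where
  carrier : Set AISr.{u}
  equational : ∃ E : Set (Term × Term), carrier = modelsId E

/-- Varieties are ordered by inclusion. -/
instance : PartialOrder AIVariety.{u} :=
  PartialOrder.lift AIVariety.carrier fun _ _ h => AIVariety.ext h

/-- The meet of a set of varieties is their intersection. -/
instance : InfSet AIVariety.{u} where
  sInf s :=
    { carrier := {S | ∀ V ∈ s, S ∈ V.carrier}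
      equational := by
        refine ⟨{e | ∃ V ∈ s, ∀ S ∈ V.carrier, SatisfiesId S e}, ?_⟩
        ext S
        constructor
        · rintro h e ⟨V, hV, he⟩
          exact he S (h V hV)
        · intro h V hV
          obtain ⟨E, hE⟩ := V.equational
          rw [hE]
          intro e he
          refine h e ⟨V, hV, fun T hT => ?_⟩
          rw [hE] at hT
          exact hT e he }

/-- The lattice of all varieties of ai-semirings: meets are intersections, joins are the least
upper bounds with respect to inclusion. -/
instance : CompleteLattice AIVariety.{u} :=
  completeLatticeOfInf _ fun _ =>
    ⟨fun V hV _ hS => hS V hV, fun _ hW _ hS _ hV => hW hV hS⟩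

/-- The variety defined by a set of identities. -/
def AIVariety.ofIds (E : Set (Term × Term)) : AIVariety.{u} := ⟨modelsId E, E, rfl⟩

/-- The variety `Sr(n, 1)` of ai-semirings defined by `x ^ n ≈ x` (for `n ≥ 2`). -/
def Sr (n : ℕ) : AIVariety.{u} :=
  .ofIds {((Term.var 0).pow n, .var 0)}

/-- The variety `M_n` of ai-semirings defined by `x ^ n ≈ x` and
`x ^ (n - 1) + y ^ (n - 1) ≈ x ^ (n - 1) * y ^ (n - 1)` (for `n ≥ 2`). -/
def M (n : ℕ) : AIVariety.{u} :=
  .ofIds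
    {((Term.var 0).pow n, .var 0),
     (.add ((Term.var 0).pow (n - 1)) ((Term.var 1).pow (n - 1)),
      .mul ((Term.var 0).pow (n - 1)) ((Term.var 1).pow (n - 1)))}

/-! ## The class operators -/

/-- Homomorphic images of members of `K`. -/
def opH (K : Set AISr.{u}) : Set AISr.{u} :=
  {B | ∃ A ∈ K, ∃ f : A → B, IsHom f ∧ Function.Surjective f}

/-- Algebras isomorphic to subalgebras of members of `K`. -/
def opS (K : Set AISr.{u}) : Set AISr.{u} :=
  {B | ∃ A ∈ K, ∃ f : B → A, IsHom f ∧ Function.Injective f}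

/-- Algebras isomorphic to direct products of (possibly empty) families of members of `K`. -/
def opP (K : Set AISr.{u}) : Set AISr.{u} :=
  {B | ∃ (ι : Type u) (A : ι → AISr.{u}), (∀ i, A i ∈ K) ∧ Nonempty (B ≃+* ∀ i, A i)}

def HSP (K : Set AISr.{u}) : Set AISr.{u} := opH (opS (opP K))

/-! ## Quasi-identities and quasivarieties of groups -/

/-- A quasi-identity `s₁ ≈ t₁ ∧ … ∧ s_k ≈ t_k → s ≈ t` in the language of groups, `k ≥ 0`. Group
terms in the variables `ℕ` are taken modulo the group axioms, i.e. as elements of the free group. -/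
structure QuasiIdentity : Type where
  premises : List (FreeGroup ℕ × FreeGroup ℕ)
  conclusion : FreeGroup ℕ × FreeGroup ℕ

/-- The group `G` satisfies the quasi-identity `q`. -/
def SatisfiesQuasi (G : Type u) [Group G] (q : QuasiIdentity) : Prop :=
  ∀ f : ℕ → G,
    (∀ p ∈ q.premises, FreeGroup.lift f p.1 = FreeGroup.lift f p.2) →
      FreeGroup.lift f q.conclusion.1 = FreeGroup.lift f q.conclusion.2

/-- The class of all groups satisfying all the quasi-identities in `Q`. -/
def modelsQuasi (Q : Set QuasiIdentity) : Set GrpCat.{u} :=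
  {G | ∀ q ∈ Q, SatisfiesQuasi G q}

/-- Quasivarieties of groups: the classes of groups defined by a set of quasi-identities. -/
@[ext]
structure GroupQuasivariety : Type (u + 1) where
  carrier : Set GrpCat.{u}
  axiomatized : ∃ Q : Set QuasiIdentity, carrier = modelsQuasi Q

/-- Quasivarieties are ordered by inclusion. -/
instance : PartialOrder GroupQuasivariety.{u} :=
  PartialOrder.lift GroupQuasivariety.carrier fun _ _ h => GroupQuasivariety.ext h

/-- The meet of a set of quasivarieties is their intersection. -/
instance : InfSet GroupQuasivariety.{u} where
  sInf s :=
    { carrier := {G | ∀ V ∈ s, G ∈ V.carrier}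
      axiomatized := by
        refine ⟨{q | ∃ V ∈ s, ∀ G ∈ V.carrier, SatisfiesQuasi G q}, ?_⟩
        ext G
        constructor
        · rintro h q ⟨V, hV, hq⟩
          exact hq G (h V hV)
        · intro h V hV
          obtain ⟨Q, hQ⟩ := V.axiomatized
          rw [hQ]
          intro q hq
          refine h q ⟨V, hV, fun T hT => ?_⟩
          rw [hQ] at hT
          exact hT q hq }

/-- The lattice of all quasivarieties of groups: meets are intersections, joins are the least
upper bounds with respect to inclusion. -/
instance : CompleteLattice GroupQuasivariety.{u} :=
  completeLatticeOfInf _ fun _ =>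
    ⟨fun V hV _ hG => hG V hV, fun _ hW _ hG _ hV => hW hV hG⟩

/-- The class `G(n, 1)` of all groups satisfying `x ^ n ≈ x`. -/
def BurnsideGroups (n : ℕ) : GroupQuasivariety.{u} where
  carrier := {G | ∀ x : G, x ^ n = x}
  axiomatized := by
    refine ⟨{⟨[], (FreeGroup.of 0 ^ n, FreeGroup.of 0)⟩}, ?_⟩
    ext G
    simp only [modelsQuasi, SatisfiesQuasi, Set.mem_ofPred_eq, Set.mem_singleton_iff, forall_eq,
      List.not_mem_nil, false_imp_iff, implies_true, true_imp_iff, map_pow, FreeGroup.lift_apply_of]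
    exact ⟨fun h f => h (f 0), fun h x => h fun _ => x⟩

/-! ## Flat extensions -/

/-- The underlying set of the flat extension `G⁰`: the group `G` with an extra element `0`. -/
def Flat (G : Type u) : Type u := WithZero G

/-- The flat extension of a group: the multiplication is that of `G` with `0` absorbing, and
`a + b` is `a` if `a = b` and `0` otherwise. -/
noncomputable instance (G : Type u) [Group G] : AISemiring (Flat G) :=
  letI : DecidableEq (WithZero G) := Classical.decEq _
  { add := fun a b : WithZero G => if a = b then a else (0 : WithZero G)
    mul := fun a b : WithZero G => a * b
    add_assoc := fun a b c : WithZero G => by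
      change (if (if a = b then a else 0) = c then (if a = b then a else 0) else 0) =
        (if a = (if b = c then b else 0) then a else (0 : WithZero G))
      split_ifs <;> simp_all
    add_comm := fun a b : WithZero G => by
      change (if a = b then a else 0) = (if b = a then b else (0 : WithZero G))
      split_ifs <;> simp_all
    mul_assoc := fun a b c : WithZero G => mul_assoc a b c
    left_distrib := fun a b c : WithZero G => by
      change a * (if b = c then b else 0) = (if a * b = a * c then a * b else 0)
      split_ifs <;> simp_all
    right_distrib := fun a b c : WithZero G => by
      change (if a = b then a else 0) * c = (if a * c = b * c then a * c else 0)
      split_ifs <;> simp_all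
    add_idem := fun a : WithZero G => if_pos rfl }

instance (G : Type u) : Nonempty (Flat G) := ⟨(0 : WithZero G)⟩

/-- The flat extension `G⁰` as a bundled ai-semiring. -/
noncomputable def flatExt (G : GrpCat.{u}) : AISr.{u} := ⟨Flat G⟩

end BurnsideAI

/-! Write n = m + 2 and e_x = x^(m+1), which is `spow x m`. In a member S of M_n each e_x is
idempotent, and e + f = ef for idempotents. Since addition is commutative, idempotents commute; they
are then central, and S is a Clifford semigroup. Moreover the additive order is dual to the natural
order (`mul_unit_of_add_eq`). Hence, for the maximal subgroup H_a at e_a, the map sending x to x e_a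
if e_a ≤ e_x, and to 0 otherwise, is a homomorphism from S to the flat extension of H_a
(`isHom_toFlat`). These maps separate points, and each is onto unless H_a is trivial. So a variety
in [M_2, M_n] is determined by the groups whose flat extensions it contains.

It remains to match logics. An identity with equal variable sets on both sides holds in G⁰ iff G
satisfies certain quasi-identities (`satisfiesId_flat_iff`); flat extensions of trivial groups,
which lie in M_2, force the variable sets to agree. Conversely, bounded exponent lets terms express
inverses, and a sum in G⁰ tests equality, so each quasi-identity becomes an identity
(`exists_identity_of_quasi`). The two passages between group quasivarieties and varieties are
therefore mutually inverse and monotone. -/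

namespace BurnsideAI

/-! ## Powers in semigroups -/

/-- The power `x ^ (k + 1)` in a semigroup. -/
def spow {S : Type u} [Semigroup S] (x : S) : ℕ → S
  | 0 => x
  | k + 1 => spow x k * x

theorem coe_spow {S : Type u} [Semigroup S] (x : S) (k : ℕ) :
    ((spow x k : S) : WithOne S) = (x : WithOne S) ^ (k + 1) := by
  induction k with
  | zero => simp [spow]
  | succ k ih => rw [spow, WithOne.coe_mul, ih, ← pow_succ]

theorem spow_of_idem {S : Type u} [Semigroup S] {e : S} (he : e * e = e) (k : ℕ) :
    spow e k = e := by
  induction k with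
  | zero => rfl
  | succ k ih => rw [spow, ih, he]

theorem mul_spow_of_mul_eq {S : Type u} [Semigroup S] {e x : S} (h : e * x = x) (k : ℕ) :
    e * spow x k = spow x k := by
  induction k with
  | zero => exact h
  | succ k ih => rw [spow, ← mul_assoc, ih]

theorem spow_mul_of_mul_eq {S : Type u} [Semigroup S] {e x : S} (h : x * e = x) (k : ℕ) :
    spow x k * e = spow x k := by
  induction k with
  | zero => exact h
  | succ k ih => rw [spow, mul_assoc, h]

theorem eval_pow_succ {S : Type u} [AISemiring S] (f : ℕ → S) (t : Term) (k : ℕ) :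
    (t.pow (k + 1)).eval f = spow (t.eval f) k := by
  induction k with
  | zero => rfl
  | succ k ih =>
    change (t.pow (k + 1)).eval f * t.eval f = _
    rw [ih, spow]

/-! ## The structure of members of `M n` -/

/-- The defining laws of `M (m + 2)`. -/
structure IsM (m : ℕ) (S : Type u) [AISemiring S] : Prop where
  pow_eq : ∀ x : S, spow x (m + 1) = x
  add_eq_mul : ∀ x y : S, spow x m + spow y m = spow x m * spow y m

theorem mem_M_iff (m : ℕ) (S : AISr.{u}) : S ∈ (M.{u} (m + 2)).carrier ↔ IsM m S := by
  constructor
  · intro h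
    refine ⟨fun x => ?_, fun x y => ?_⟩
    · have := h _ (Set.mem_insert _ _) (fun _ => x)
      simpa only [eval_pow_succ, Term.eval] using this
    · have := h _ (Set.mem_insert_of_mem _ rfl) (fun i => if i = 0 then x else y)
      simp only [show m + 2 - 1 = m + 1 from rfl, Term.eval,
        eval_pow_succ] at this
      exact this
  · rintro h e (rfl | rfl) f
    · simpa only [eval_pow_succ, Term.eval] using h.pow_eq (f 0)
    · simpa only [show m + 2 - 1 = m + 1 from rfl, eval_pow_succ, Term.eval] using
        h.add_eq_mul (f 0) (f 1)

namespace IsM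

variable {m : ℕ} {S : Type u} [AISemiring S]

theorem coe_pow_eq (h : IsM m S) (x : S) : (x : WithOne S) ^ (m + 2) = x := by
  rw [← coe_spow, h.pow_eq]

theorem coe_pow_idem (h : IsM m S) (x : S) :
    (x : WithOne S) ^ (m + 1) * (x : WithOne S) ^ (m + 1) = (x : WithOne S) ^ (m + 1) := by
  rw [← pow_add, show m + 1 + (m + 1) = m + 2 + m by ring, pow_add, h.coe_pow_eq, ← pow_succ']

theorem idem (h : IsM m S) (x : S) : spow x m * spow x m = spow x m := by
  rw [← WithOne.coe_inj, WithOne.coe_mul, coe_spow, h.coe_pow_idem]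

theorem unit_mul (h : IsM m S) (x : S) : spow x m * x = x := h.pow_eq x

theorem mul_unit (h : IsM m S) (x : S) : x * spow x m = x := by
  rw [← WithOne.coe_inj, WithOne.coe_mul, coe_spow, ← pow_succ', h.coe_pow_eq]

/-- The inverse of x in its maximal subgroup is taken to be x^(2m+1) rather than x^m, because x^m is
not a semigroup power when m = 0. -/
theorem mul_inv (h : IsM m S) (x : S) : x * spow x (2 * m) = spow x m := by
  rw [← WithOne.coe_inj, WithOne.coe_mul, coe_spow, coe_spow, ← pow_succ',
    show 2 * m + 1 + 1 = m + 1 + (m + 1) by ring, pow_add, h.coe_pow_idem]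

theorem inv_mul (h : IsM m S) (x : S) : spow x (2 * m) * x = spow x m := by
  rw [← WithOne.coe_inj, WithOne.coe_mul, coe_spow, coe_spow, ← pow_succ,
    show 2 * m + 1 + 1 = m + 1 + (m + 1) by ring, pow_add, h.coe_pow_idem]

theorem spow_inv (h : IsM m S) (x : S) : spow (spow x (2 * m)) m = spow x m := by
  have h2 := spow_of_idem (h.idem x) (2 * m)
  rw [← WithOne.coe_inj, coe_spow, coe_spow] at h2
  rw [← WithOne.coe_inj, coe_spow, coe_spow, coe_spow, ← pow_mul, mul_comm, pow_mul, h2]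

theorem add_eq (h : IsM m S) {e f : S} (he : e * e = e) (hf : f * f = f) : e + f = e * f := by
  have := h.add_eq_mul e f
  rwa [spow_of_idem he, spow_of_idem hf] at this

theorem idem_comm (h : IsM m S) {e f : S} (he : e * e = e) (hf : f * f = f) : e * f = f * e := by
  rw [← h.add_eq he hf, ← h.add_eq hf he, add_comm]

/-- The idempotent e fixes e_y on the left and commutes with it, hence fixes it on the right; then y
= y e_y gives the claim. -/
theorem mul_right_of_left (h : IsM m S) {e y : S} (he : e * e = e) (hy : e * y = y) :
    y * e = y := by
  have : spow y m * e = spow y m := by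
    rw [h.idem_comm (h.idem y) he, mul_spow_of_mul_eq hy]
  rw [← h.mul_unit y, mul_assoc, this]

theorem mul_left_of_right (h : IsM m S) {e y : S} (he : e * e = e) (hy : y * e = y) :
    e * y = y := by
  have : e * spow y m = spow y m := by
    rw [h.idem_comm he (h.idem y), spow_mul_of_mul_eq hy]
  rw [← h.unit_mul y, ← mul_assoc, this]

/-- Idempotents are central. -/
theorem central (h : IsM m S) {e : S} (he : e * e = e) (x : S) : e * x = x * e := by
  have h1 : e * x * e = e * x := h.mul_right_of_left he (by rw [← mul_assoc, he])
  have h2 : e * (x * e) = x * e := h.mul_left_of_right he (by rw [mul_assoc, he])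
  rw [← h1, mul_assoc, h2]

/-- The idempotent e_x e_y is a left identity for xy and also equals xy times y⁻¹x⁻¹, so it and
e_{xy} absorb each other. -/
theorem unit_of_mul (h : IsM m S) (x y : S) : spow (x * y) m = spow x m * spow y m := by
  have hxy : spow x m * spow y m * (spow x m * spow y m) = spow x m * spow y m := by
    rw [mul_assoc, h.central (h.idem y), mul_assoc, h.idem y, ← mul_assoc, h.idem]
  have h1 : spow x m * spow y m * (x * y) = x * y := by
    rw [mul_assoc, ← mul_assoc (spow y m), h.central (h.idem y), mul_assoc, h.unit_mul,
      ← mul_assoc, h.unit_mul]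
  have h2 : x * y * (spow y (2 * m) * spow x (2 * m)) = spow x m * spow y m := by
    rw [mul_assoc, ← mul_assoc y, h.mul_inv, h.central (h.idem y), ← mul_assoc, h.mul_inv]
  have h3 : spow (x * y) m * (spow x m * spow y m) = spow x m * spow y m := by
    rw [← h2, ← mul_assoc, h.unit_mul]
  rw [← h3, h.idem_comm (h.idem _) hxy, mul_spow_of_mul_eq h1]

theorem unit_mul_of_idem (h : IsM m S) {e : S} (he : e * e = e) (x : S) :
    spow (x * e) m = spow x m * e := by
  rw [h.unit_of_mul, spow_of_idem he]

/-- Read u + v = v as u ≤ v. Multiplying b ≤ f by powers of b gives a descending chain b ≥ b² ≥ b³ ≥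
…, which returns to b at b^(m+2). So b is idempotent, and f = b + f = bf = b. -/
theorem eq_of_add_idem_eq (h : IsM m S) {b f : S} (hf : f * f = f) (hbf : b * f = b)
    (hadd : b + f = f) : b = f := by
  have h1 : b * b + b = b := by
    calc b * b + b = b * b + b * f := by rw [hbf]
      _ = b := by rw [← mul_add, hadd, hbf]
  have h2 : ∀ k, b * b + spow b (k + 1) = b * b := by
    intro k
    induction k with
    | zero => exact AISemiring.add_idem _
    | succ k ih =>
      have h3 : spow b (k + 1) + spow b (k + 1 + 1) = spow b (k + 1) := by
        change spow b k * b + spow b k * b * b = spow b k * b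
        rw [mul_assoc, ← mul_add, add_comm b, h1]
      rw [← ih, add_assoc, h3]
  have h3 : b * b = b := by
    have h4 := h2 m
    rw [h.pow_eq, h1] at h4
    exact h4.symm
  rw [← hadd, h.add_eq h3 hf, hbf]

/-- The additive order is dual to the natural order of the Clifford semigroup `S`. -/
theorem mul_unit_of_add_eq (h : IsM m S) {x c : S} (hxc : x + c = c) : x * spow c m = c := by
  -- Multiplying x + c = c by c⁻¹ reduces to comparison with the idempotent e_c.
  have hb : x * spow c (2 * m) = spow c m := by
    apply h.eq_of_add_idem_eq (h.idem c)
    · rw [mul_assoc]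
      congr 1
      have := h.mul_unit (spow c (2 * m))
      rwa [h.spow_inv] at this
    · rw [← h.mul_inv c, ← add_mul, hxc]
  rw [← h.inv_mul, ← mul_assoc, hb, h.unit_mul]

end IsM

/-! ## Maximal subgroups -/

/-- The maximal subgroup of `S` containing the idempotent `x ^ (m + 1)`. -/
@[ext]
structure MaxSubgroup {m : ℕ} {S : Type u} [AISemiring S] (h : IsM m S) (a : S) : Type u where
  val : S
  unit_eq : spow val m = spow a m

instance {m : ℕ} {S : Type u} [AISemiring S] (h : IsM m S) (a : S) :
    Group (MaxSubgroup h a) where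
  mul x y := ⟨x.1 * y.1, by rw [h.unit_of_mul, x.2, y.2, h.idem]⟩
  mul_assoc x y z := MaxSubgroup.ext (mul_assoc x.1 y.1 z.1)
  one := ⟨spow a m, spow_of_idem (h.idem a) m⟩
  one_mul x := MaxSubgroup.ext (by
    change spow a m * x.1 = x.1
    rw [← x.unit_eq, h.unit_mul])
  mul_one x := MaxSubgroup.ext (by
    change x.1 * spow a m = x.1
    rw [← x.2, h.mul_unit])
  inv x := ⟨spow x.1 (2 * m), by rw [h.spow_inv, x.2]⟩
  inv_mul_cancel x := MaxSubgroup.ext (by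
    change spow x.1 (2 * m) * x.1 = spow a m
    rw [h.inv_mul, x.2])

/-! ## Arithmetic in flat extensions -/

namespace Flat

variable {G : Type u}

/-- The inclusion of `G` in its flat extension. -/
def of (g : G) : Flat G := (g : WithZero G)

/-- The zero of the flat extension. -/
def zero : Flat G := (0 : WithZero G)

theorem of_injective : Function.Injective (of : G → Flat G) := fun _ _ h => WithZero.coe_inj.1 h

theorem of_ne_zero (g : G) : of g ≠ zero := WithZero.coe_ne_zero

theorem cases (a : Flat G) : a = zero ∨ ∃ g, a = of g := by
  induction a using WithZero.recZeroCoe with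
  | zero => exact Or.inl rfl
  | coe g => exact Or.inr ⟨g, rfl⟩

variable [Group G]

theorem of_mul (a b : G) : of (a * b) = of a * of b := WithZero.coe_mul a b

theorem zero_mul (a : Flat G) : zero * a = zero := MulZeroClass.zero_mul (M₀ := WithZero G) a

theorem mul_zero (a : Flat G) : a * zero = zero := MulZeroClass.mul_zero (M₀ := WithZero G) a

theorem add_of_ne {a b : Flat G} (h : a ≠ b) : a + b = zero := if_neg h

theorem add_self (a : Flat G) : a + a = a := if_pos rfl

theorem zero_add (a : Flat G) : zero + a = zero := by
  by_cases h : zero = a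
  · rw [← h, add_self]
  · exact add_of_ne h

theorem add_zero (a : Flat G) : a + zero = zero := by rw [add_comm, zero_add]

theorem eq_of_add_ne_zero {a b : Flat G} (h : a + b ≠ zero) : a = b := by
  by_contra hab
  exact h (add_of_ne hab)

theorem spow_of (g : G) (k : ℕ) : spow (of g) k = of (g ^ (k + 1)) := by
  induction k with
  | zero => simp [spow]
  | succ k ih => rw [spow, ih, ← of_mul, ← pow_succ]

theorem spow_zero (k : ℕ) : spow (zero : Flat G) k = zero := by
  cases k with
  | zero => rfl
  | succ k => exact mul_zero _

end Flat

theorem isM_flat {m : ℕ} {G : Type u} [Group G] (h : ∀ x : G, x ^ (m + 1) = 1) :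
    IsM m (Flat G) := by
  refine ⟨fun x => ?_, fun x y => ?_⟩
  · obtain rfl | ⟨g, rfl⟩ := x.cases
    · exact Flat.spow_zero _
    · rw [Flat.spow_of, pow_succ, h, one_mul]
  · obtain rfl | ⟨g, rfl⟩ := x.cases
    · rw [Flat.spow_zero, Flat.zero_add, Flat.zero_mul]
    obtain rfl | ⟨k, rfl⟩ := y.cases
    · rw [Flat.spow_zero, Flat.add_zero, Flat.mul_zero]
    rw [Flat.spow_of, Flat.spow_of, h, h, Flat.add_self, ← Flat.of_mul, mul_one]

theorem pow_eq_one_of_isM_flat {m : ℕ} {G : Type u} [Group G] (h : IsM m (Flat G)) (x : G) :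
    x ^ (m + 1) = 1 := by
  have h1 := h.pow_eq (Flat.of x)
  rw [Flat.spow_of] at h1
  have h2 := Flat.of_injective h1
  rwa [pow_succ, mul_eq_right] at h2

theorem mem_burnsideGroups_iff (m : ℕ) (G : GrpCat.{u}) :
    G ∈ (BurnsideGroups.{u} (m + 2)).carrier ↔ ∀ x : G, x ^ (m + 1) = 1 := by
  change (∀ x : G, x ^ (m + 2) = x) ↔ _
  refine forall_congr' fun x => ?_
  rw [show m + 2 = m + 1 + 1 from rfl, pow_succ, mul_eq_right]

/-! ## The canonical homomorphisms to flat extensions of maximal subgroups -/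

namespace IsM

variable {m : ℕ} {S : Type u} [AISemiring S]

open Classical in
/-- The homomorphism from `S` to the flat extension of the maximal subgroup at `a ^ (m + 1)`. -/
noncomputable def toFlat (h : IsM m S) (a x : S) : Flat (MaxSubgroup h a) :=
  if hx : spow x m * spow a m = spow a m then
    Flat.of ⟨x * spow a m, by rw [h.unit_mul_of_idem (h.idem a), hx]⟩
  else Flat.zero

theorem toFlat_of_not (h : IsM m S) {a x : S} (hx : ¬ spow x m * spow a m = spow a m) :
    h.toFlat a x = Flat.zero := dif_neg hx

theorem toFlat_of (h : IsM m S) {a x : S} (hx : spow x m * spow a m = spow a m) :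
    h.toFlat a x = Flat.of ⟨x * spow a m, by rw [h.unit_mul_of_idem (h.idem a), hx]⟩ :=
  dif_pos hx

theorem toFlat_eq_iff (h : IsM m S) {a x y : S} (hx : spow x m * spow a m = spow a m) :
    h.toFlat a x = h.toFlat a y ↔
      spow y m * spow a m = spow a m ∧ x * spow a m = y * spow a m := by
  rw [h.toFlat_of hx]
  by_cases hy : spow y m * spow a m = spow a m
  · rw [h.toFlat_of hy, Flat.of_injective.eq_iff]
    exact ⟨fun H => ⟨hy, congrArg MaxSubgroup.val H⟩, fun H => MaxSubgroup.ext H.2⟩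
  · rw [h.toFlat_of_not hy]
    exact ⟨fun H => (Flat.of_ne_zero _ H).elim, fun H => (hy H.1).elim⟩

theorem isHom_toFlat (h : IsM m S) (a : S) : IsHom (h.toFlat a) := by
  refine ⟨fun x y => ?_, fun x y => ?_⟩
  -- Both summands lie above x + y in the natural order: each restricts to x + y under
  -- multiplication by its idempotent.
  · have hx : x * spow (x + y) m = x + y :=
      h.mul_unit_of_add_eq (by rw [← add_assoc, AISemiring.add_idem])
    have hy : y * spow (x + y) m = x + y :=
      h.mul_unit_of_add_eq (by rw [add_comm x y, ← add_assoc, AISemiring.add_idem])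
    by_cases hc : spow (x + y) m * spow a m = spow a m
    · have key : ∀ z, z * spow (x + y) m = x + y → h.toFlat a (x + y) = h.toFlat a z := by
        intro z hz
        rw [h.toFlat_eq_iff hc]
        have h1 : spow z m * spow (x + y) m = spow (x + y) m := by
          rw [← h.unit_mul_of_idem (h.idem _), hz]
        constructor
        · rw [← hc, ← mul_assoc, h1]
        · conv_rhs => rw [← hc, ← mul_assoc, hz]
      rw [← key x hx, ← key y hy, Flat.add_self]
    · rw [h.toFlat_of_not hc]
      -- If the images of x and y were equal and nonzero, then (x + y)e_a = x e_a would lie in H_a,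
      -- forcing e_a ≤ e_{x+y}.
      by_contra hne
      have hxy := Flat.eq_of_add_ne_zero (Ne.symm hne)
      by_cases hx0 : spow x m * spow a m = spow a m
      · obtain ⟨-, h1⟩ := (h.toFlat_eq_iff hx0).1 hxy
        apply hc
        rw [← h.unit_mul_of_idem (h.idem _), add_mul, ← h1, AISemiring.add_idem,
          h.unit_mul_of_idem (h.idem _), hx0]
      · rw [h.toFlat_of_not hx0, Flat.zero_add] at hne
        exact hne rfl
  · by_cases hx : spow x m * spow a m = spow a m
    · by_cases hy : spow y m * spow a m = spow a m
      · have hxy : spow (x * y) m * spow a m = spow a m := by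
          rw [h.unit_of_mul, mul_assoc, hy, hx]
        rw [h.toFlat_of hx, h.toFlat_of hy, h.toFlat_of hxy, ← Flat.of_mul]
        congr 1
        apply MaxSubgroup.ext
        change x * y * spow a m = x * spow a m * (y * spow a m)
        rw [mul_assoc x (spow a m), ← mul_assoc (spow a m) y, h.central (h.idem a) y,
          mul_assoc y, h.idem, ← mul_assoc]
      · rw [h.toFlat_of_not hy, Flat.mul_zero, h.toFlat_of_not]
        intro hxy
        apply hy
        rw [h.unit_of_mul, h.idem_comm (h.idem x) (h.idem y)] at hxy
        rw [← hxy, ← mul_assoc, ← mul_assoc, h.idem]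
    · rw [h.toFlat_of_not hx, Flat.zero_mul, h.toFlat_of_not]
      intro hxy
      apply hx
      rw [h.unit_of_mul] at hxy
      rw [← hxy, ← mul_assoc, ← mul_assoc, h.idem]

/-- The components at x and at y already suffice: they give e_x = e_y, and then x = y. -/
theorem toFlat_jointly_injective (h : IsM m S) {x y : S}
    (hxy : ∀ a, h.toFlat a x = h.toFlat a y) : x = y := by
  obtain ⟨h1, h2⟩ := (h.toFlat_eq_iff (h.idem x)).1 (hxy x)
  obtain ⟨h3, -⟩ := (h.toFlat_eq_iff (h.idem y)).1 (hxy y).symm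
  have h4 : spow x m = spow y m := by
    rw [← h1, h.idem_comm (h.idem y) (h.idem x), h3]
  rw [h.mul_unit, h4, h.mul_unit] at h2
  exact h2

/-- The only value that can be missed is 0. If it is, the images of x and y in H_a have a nonzero
sum, so they coincide and H_a is trivial. -/
theorem toFlat_surjective_or (h : IsM m S) (a : S) :
    Function.Surjective (h.toFlat a) ∨ Subsingleton (MaxSubgroup h a) := by
  by_cases H : ∀ x : S, spow x m * spow a m = spow a m
  · right
    refine ⟨fun x y => MaxSubgroup.ext ?_⟩
    have h1 := (h.isHom_toFlat a).1 x.1 y.1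
    rw [h.toFlat_of (H (x.1 + y.1))] at h1
    have h2 := Flat.eq_of_add_ne_zero (h1 ▸ Flat.of_ne_zero _)
    have h3 := ((h.toFlat_eq_iff (H x.1)).1 h2).2
    have hx := h.mul_unit x.1
    have hy := h.mul_unit y.1
    rw [x.2] at hx
    rw [y.2] at hy
    rw [← hx, h3, hy]
  · left
    push Not at H
    obtain ⟨x, hx⟩ := H
    intro z
    obtain rfl | ⟨g, rfl⟩ := z.cases
    · exact ⟨x, h.toFlat_of_not hx⟩
    · refine ⟨g.1, ?_⟩
      have hg : spow g.1 m * spow a m = spow a m := by rw [g.2, h.idem]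
      rw [h.toFlat_of hg]
      congr 1
      apply MaxSubgroup.ext
      change g.1 * spow a m = g.1
      rw [← g.2, h.mul_unit]

end IsM

/-! ## Preservation of identities -/

theorem IsHom.map_eval {A B : Type u} [AISemiring A] [AISemiring B] {φ : A → B} (h : IsHom φ)
    (f : ℕ → A) (t : Term) : φ (t.eval f) = t.eval (φ ∘ f) := by
  induction t with
  | var i => rfl
  | add s t hs ht => rw [Term.eval, Term.eval, h.1, hs, ht]
  | mul s t hs ht => rw [Term.eval, Term.eval, h.2, hs, ht]

theorem satisfiesId_of_surjective {A B : Type u} [AISemiring A] [AISemiring B] {φ : A → B}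
    (h : IsHom φ) (hs : Function.Surjective φ) {e : Term × Term} (he : SatisfiesId A e) :
    SatisfiesId B e := by
  intro f
  obtain ⟨g, hg⟩ : ∃ g : ℕ → A, φ ∘ g = f :=
    ⟨fun i => Function.surjInv hs (f i), funext fun i => Function.surjInv_eq hs _⟩
  rw [← hg, ← h.map_eval, ← h.map_eval, he g]

theorem satisfiesId_of_separating {A : Type u} [AISemiring A] {ι : Type*} {B : ι → Type u}
    [∀ i, AISemiring (B i)] {φ : ∀ i, A → B i} (h : ∀ i, IsHom (φ i))
    (hsep : ∀ x y, (∀ i, φ i x = φ i y) → x = y) {e : Term × Term}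
    (he : ∀ i, SatisfiesId (B i) e) : SatisfiesId A e := by
  intro f
  refine hsep _ _ fun i => ?_
  rw [(h i).map_eval, (h i).map_eval, he i]

instance Pi.instAISemiring {ι : Type u} (A : ι → AISr.{u}) : AISemiring (∀ i, A i) where
  add_assoc a b c := funext fun i => add_assoc (a i) (b i) (c i)
  add_comm a b := funext fun i => add_comm (a i) (b i)
  mul_assoc a b c := funext fun i => mul_assoc (a i) (b i) (c i)
  left_distrib a b c := funext fun i => left_distrib (a i) (b i) (c i)
  right_distrib a b c := funext fun i => right_distrib (a i) (b i) (c i)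
  add_idem a := funext fun i => AISemiring.add_idem (a i)

theorem satisfiesId_of_mem_HSP {K : Set AISr.{u}} {e : Term × Term}
    (hK : ∀ A ∈ K, SatisfiesId A e) {S : AISr.{u}} (hS : S ∈ HSP K) : SatisfiesId S e := by
  obtain ⟨B, ⟨C, ⟨ι, A, hA, ⟨eqv⟩⟩, j, hj, hinj⟩, f, hf, hsurj⟩ := hS
  refine satisfiesId_of_surjective hf hsurj ?_
  refine satisfiesId_of_separating (φ := fun i x => eqv (j x) i) (fun i => ⟨fun x y => ?_,
    fun x y => ?_⟩) (fun x y hxy => hinj (eqv.injective (funext hxy)))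
    (fun i => hK _ (hA i))
  · change eqv (j (x + y)) i = _
    rw [hj.1, map_add, Pi.add_apply]
  · change eqv (j (x * y)) i = _
    rw [hj.2, map_mul, Pi.mul_apply]

theorem mem_HSP_of_separating {K : Set AISr.{u}} {S : AISr.{u}} {ι : Type u} (B : ι → AISr.{u})
    (hB : ∀ i, B i ∈ K) (φ : ∀ i, S → B i) (h : ∀ i, IsHom (φ i))
    (hsep : ∀ x y, (∀ i, φ i x = φ i y) → x = y) : S ∈ HSP K :=
  ⟨S, ⟨⟨∀ i, B i⟩, ⟨ι, B, hB, ⟨RingEquiv.refl _⟩⟩, fun x i => φ i x,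
    ⟨fun x y => funext fun i => (h i).1 x y, fun x y => funext fun i => (h i).2 x y⟩,
    fun x y hxy => hsep x y fun i => congrFun hxy i⟩, id, ⟨fun _ _ => rfl, fun _ _ => rfl⟩,
    Function.surjective_id⟩

/-! ## Terms in flat extensions -/

namespace Term

/-- The variables of a term. -/
def vars : Term → Set ℕ
  | .var i => {i}
  | .add s t => s.vars ∪ t.vars
  | .mul s t => s.vars ∪ t.vars

/-- The leftmost of the words whose sum is the given term. -/
def word : Term → FreeGroup ℕ
  | .var i => FreeGroup.of i
  | .add s _ => s.word
  | .mul s t => s.word * t.word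

/-- Equations expressing that a term does not vanish in a flat extension. -/
def prem : Term → List (FreeGroup ℕ × FreeGroup ℕ)
  | .var _ => []
  | .add s t => (s.word, t.word) :: (s.prem ++ t.prem)
  | .mul s t => s.prem ++ t.prem

theorem vars_pow_succ (t : Term) (k : ℕ) : (t.pow (k + 1)).vars = t.vars := by
  induction k with
  | zero => rfl
  | succ k ih =>
    change (t.pow (k + 1)).vars ∪ t.vars = _
    rw [ih, Set.union_self]

theorem eval_congr {S : Type u} [AISemiring S] {f g : ℕ → S} (t : Term)
    (h : ∀ i ∈ t.vars, f i = g i) : t.eval f = t.eval g := by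
  induction t with
  | var i => exact h i rfl
  | add s t hs ht =>
    rw [Term.eval, Term.eval, hs fun i hi => h i (Or.inl hi), ht fun i hi => h i (Or.inr hi)]
  | mul s t hs ht =>
    rw [Term.eval, Term.eval, hs fun i hi => h i (Or.inl hi), ht fun i hi => h i (Or.inr hi)]

variable {G : Type u} [Group G]

theorem eval_eq_zero {f : ℕ → Flat G} {t : Term} {i : ℕ} (hi : i ∈ t.vars)
    (h : f i = Flat.zero) : t.eval f = Flat.zero := by
  induction t with
  | var j => rw [Term.eval, ← h, show i = j from hi]
  | add s t hs ht =>
    rcases hi with hi | hi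
    · rw [Term.eval, hs hi, Flat.zero_add]
    · rw [Term.eval, ht hi, Flat.add_zero]
  | mul s t hs ht =>
    rcases hi with hi | hi
    · rw [Term.eval, hs hi, Flat.zero_mul]
    · rw [Term.eval, ht hi, Flat.mul_zero]

theorem eval_eq_one [Subsingleton G] {f : ℕ → Flat G} {t : Term}
    (h : ∀ i ∈ t.vars, f i ≠ Flat.zero) : t.eval f = Flat.of 1 := by
  induction t with
  | var j =>
    obtain h0 | ⟨g, hg⟩ := (f j).cases
    · exact (h j rfl h0).elim
    · rw [Term.eval, hg, Subsingleton.elim g 1]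
  | add s t hs ht =>
    rw [Term.eval, hs fun i hi => h i (Or.inl hi), ht fun i hi => h i (Or.inr hi), Flat.add_self]
  | mul s t hs ht =>
    rw [Term.eval, hs fun i hi => h i (Or.inl hi), ht fun i hi => h i (Or.inr hi),
      ← Flat.of_mul, mul_one]

theorem eval_of_prem (f : ℕ → G) (t : Term)
    (h : ∀ p ∈ t.prem, FreeGroup.lift f p.1 = FreeGroup.lift f p.2) :
    t.eval (Flat.of ∘ f) = Flat.of (FreeGroup.lift f t.word) := by
  induction t with
  | var i => rw [word, FreeGroup.lift_apply_of]; rfl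
  | add s t hs ht =>
    rw [prem, List.forall_mem_cons, List.forall_mem_append] at h
    rw [Term.eval, hs h.2.1, ht h.2.2, word, ← h.1, Flat.add_self]
  | mul s t hs ht =>
    rw [prem, List.forall_mem_append] at h
    rw [Term.eval, hs h.1, ht h.2, word, map_mul, Flat.of_mul]

theorem prem_of_eval (f : ℕ → G) (t : Term) (h : t.eval (Flat.of ∘ f) ≠ Flat.zero) :
    ∀ p ∈ t.prem, FreeGroup.lift f p.1 = FreeGroup.lift f p.2 := by
  induction t with
  | var i => simp [prem]
  | add s t hs ht =>
    rw [Term.eval] at h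
    have hst := Flat.eq_of_add_ne_zero h
    rw [← hst, Flat.add_self] at h
    have h1 := hs h
    have h2 := ht (hst ▸ h)
    rw [eval_of_prem f s h1, eval_of_prem f t h2] at hst
    rw [prem, List.forall_mem_cons, List.forall_mem_append]
    exact ⟨Flat.of_injective hst, h1, h2⟩
  | mul s t hs ht =>
    rw [Term.eval] at h
    rw [prem, List.forall_mem_append]
    exact ⟨hs fun h0 => h (by rw [h0, Flat.zero_mul]), ht fun h0 => h (by rw [h0, Flat.mul_zero])⟩

end Term

theorem exists_lift_of_ne_zero {G : Type u} [Group G] {f : ℕ → Flat G} {s : Set ℕ}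
    (h : ∀ i ∈ s, f i ≠ Flat.zero) : ∃ g : ℕ → G, ∀ i ∈ s, f i = Flat.of (g i) := by
  have : ∀ i, ∃ g : G, i ∈ s → f i = Flat.of g := by
    intro i
    obtain h0 | ⟨g, hg⟩ := (f i).cases
    · exact ⟨1, fun hi => (h i hi h0).elim⟩
    · exact ⟨g, fun _ => hg⟩
  choose g hg using this
  exact ⟨g, hg⟩

/-- An identity with the same variables on both sides holds in a flat extension as soon as it
holds for the group-valued assignments. -/
theorem satisfiesId_flat {G : Type u} [Group G] {e : Term × Term} (hv : e.1.vars = e.2.vars)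
    (h : ∀ f : ℕ → G, e.1.eval (Flat.of ∘ f) = e.2.eval (Flat.of ∘ f)) :
    SatisfiesId (Flat G) e := by
  intro f
  by_cases H : ∃ i ∈ e.1.vars, f i = Flat.zero
  · obtain ⟨i, hi, h0⟩ := H
    rw [Term.eval_eq_zero hi h0, Term.eval_eq_zero (hv ▸ hi) h0]
  · push Not at H
    obtain ⟨g, hg⟩ := exists_lift_of_ne_zero H
    rw [Term.eval_congr e.1 (g := Flat.of ∘ g) hg,
      Term.eval_congr e.2 (g := Flat.of ∘ g) (hv ▸ hg), h]

-- Sending one variable to 0 and all others to 1 detects whether that variable occurs in a term.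
open Classical in
theorem vars_subset_of_satisfiesId {e : Term × Term} (h : SatisfiesId (Flat PUnit.{u + 1}) e) :
    e.2.vars ⊆ e.1.vars := by
  intro i hi
  by_contra hi1
  have := h fun j => if j = i then Flat.zero else Flat.of 1
  rw [Term.eval_eq_zero (i := i) (t := e.2) hi (if_pos rfl), Term.eval_eq_one] at this
  · exact Flat.of_ne_zero _ this
  · intro j hj
    rw [if_neg fun hji : j = i => hi1 (hji ▸ hj)]
    exact Flat.of_ne_zero _

theorem vars_eq_of_satisfiesId {e : Term × Term} (h : SatisfiesId (Flat PUnit.{u + 1}) e) :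
    e.1.vars = e.2.vars :=
  (vars_subset_of_satisfiesId (e := (e.2, e.1)) fun f => (h f).symm).antisymm
    (vars_subset_of_satisfiesId h)

/-- The quasi-identities expressing `s ≈ s + t` in flat extensions. -/
def quasiOfTerms (s t : Term) : Set QuasiIdentity :=
  insert ⟨s.prem, (s.word, t.word)⟩ {q | ∃ p ∈ t.prem, q = ⟨s.prem, p⟩}

/-- A term is nonzero exactly when its premises hold, and its value is then that of its leftmost
word. So the quasi-identities must yield both the premises of t and the equality of the two words.
-/
theorem satisfiesQuasi_quasiOfTerms_iff {G : Type u} [Group G] (s t : Term) :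
    (∀ q ∈ quasiOfTerms s t, SatisfiesQuasi G q) ↔
      ∀ f : ℕ → G, s.eval (Flat.of ∘ f) ≠ Flat.zero →
        s.eval (Flat.of ∘ f) = t.eval (Flat.of ∘ f) := by
  constructor
  · intro h f hs
    have hp := s.prem_of_eval f hs
    rw [s.eval_of_prem f hp, t.eval_of_prem f fun p hpt => h _ (Or.inr ⟨p, hpt, rfl⟩) f hp]
    exact congrArg Flat.of (h _ (Or.inl rfl) f hp)
  · intro h
    have key : ∀ f : ℕ → G, (∀ p ∈ s.prem, FreeGroup.lift f p.1 = FreeGroup.lift f p.2) →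
        FreeGroup.lift f s.word = FreeGroup.lift f t.word ∧
          ∀ p ∈ t.prem, FreeGroup.lift f p.1 = FreeGroup.lift f p.2 := by
      intro f hp
      have h1 := s.eval_of_prem f hp
      have h2 := h f (h1 ▸ Flat.of_ne_zero _)
      have h3 := t.prem_of_eval f (by rw [← h2, h1]; exact Flat.of_ne_zero _)
      rw [h1, t.eval_of_prem f h3] at h2
      exact ⟨Flat.of_injective h2, h3⟩
    rintro q (rfl | ⟨p, hpt, rfl⟩) f hp
    · exact (key f hp).1
    · exact (key f hp).2 p hpt

theorem satisfiesId_flat_iff {G : Type u} [Group G] {e : Term × Term}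
    (hv : e.1.vars = e.2.vars) :
    SatisfiesId (Flat G) e ↔
      ∀ q ∈ quasiOfTerms e.1 e.2 ∪ quasiOfTerms e.2 e.1, SatisfiesQuasi G q := by
  simp only [Set.mem_union, or_imp, forall_and]
  rw [satisfiesQuasi_quasiOfTerms_iff, satisfiesQuasi_quasiOfTerms_iff]
  constructor
  · exact fun h => ⟨fun f _ => h _, fun f _ => (h _).symm⟩
  · rintro ⟨h1, h2⟩
    refine satisfiesId_flat hv fun f => ?_
    by_cases h : e.1.eval (Flat.of ∘ f) = Flat.zero
    · by_cases h' : e.2.eval (Flat.of ∘ f) = Flat.zero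
      · rw [h, h']
      · exact (h2 f h').symm
    · exact h1 f h

/-! ## Quasi-identities as identities of flat extensions -/

/-- Bounded exponent makes 1 and inverses expressible by positive powers, uniformly in G. -/
theorem exists_term_of_freeGroup (m : ℕ) (w : FreeGroup ℕ) :
    ∃ t : Term, ∀ (G : Type u) [Group G], (∀ x : G, x ^ (m + 1) = 1) →
      ∀ f : ℕ → G, t.eval (Flat.of ∘ f) = Flat.of (FreeGroup.lift f w) := by
  induction w using FreeGroup.induction_on with
  | C1 =>
    refine ⟨(Term.var 0).pow (m + 1), fun G _ h f => ?_⟩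
    rw [eval_pow_succ, Term.eval, Function.comp_apply, Flat.spow_of, h, map_one]
  | of i =>
    refine ⟨.var i, fun G _ h f => ?_⟩
    rw [Term.eval, FreeGroup.lift_apply_of]
    rfl
  | inv_of i _ =>
    refine ⟨(Term.var i).pow (2 * m + 1), fun G _ h f => ?_⟩
    rw [eval_pow_succ, Term.eval, Function.comp_apply, Flat.spow_of, map_inv,
      FreeGroup.lift_apply_of]
    congr 1
    rw [eq_inv_iff_mul_eq_one, ← pow_succ, show 2 * m + 1 + 1 = (m + 1) + (m + 1) by ring,
      pow_add, h, one_mul]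
  | mul x y hx hy =>
    obtain ⟨s, hs⟩ := hx
    obtain ⟨t, ht⟩ := hy
    refine ⟨.mul s t, fun G _ h f => ?_⟩
    rw [Term.eval, hs G h, ht G h, ← Flat.of_mul, map_mul]

/-- A term that evaluates to `1` in flat extensions if the given equations hold and to `0`
otherwise. -/
theorem exists_term_of_premises (m : ℕ) (t : Term) (L : List (FreeGroup ℕ × FreeGroup ℕ)) :
    ∃ s : Term, t.vars ⊆ s.vars ∧ ∀ (G : Type u) [Group G], (∀ x : G, x ^ (m + 1) = 1) →
      ∀ f : ℕ → G, t.eval (Flat.of ∘ f) ≠ Flat.zero →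
        (s.eval (Flat.of ∘ f) = Flat.zero ∨ s.eval (Flat.of ∘ f) = Flat.of 1) ∧
        (s.eval (Flat.of ∘ f) = Flat.of 1 ↔
          ∀ p ∈ L, FreeGroup.lift f p.1 = FreeGroup.lift f p.2) := by
  induction L with
  | nil =>
    -- This power has value 1 and already contains every variable of t.
    refine ⟨t.pow (m + 1), (t.vars_pow_succ m).ge, fun G _ h f ht => ?_⟩
    obtain h0 | ⟨g, hg⟩ := (t.eval (Flat.of ∘ f)).cases
    · exact (ht h0).elim
    · rw [eval_pow_succ, hg, Flat.spow_of, h]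
      simp
  | cons p L ih =>
    obtain ⟨s, hts, hs⟩ := ih
    obtain ⟨r, hr⟩ := exists_term_of_freeGroup m (p.1 * p.2⁻¹)
    -- Here r has the value of p.1 p.2⁻¹, so adding it keeps the value 1 if the equation p holds and
    -- gives 0 otherwise.
    refine ⟨.add s r, hts.trans Set.subset_union_left, fun G _ h f ht => ?_⟩
    obtain ⟨h1, h2⟩ := hs G h f ht
    rw [List.forall_mem_cons, ← h2, Term.eval, hr G h, map_mul, map_inv]
    rw [show FreeGroup.lift f p.1 = FreeGroup.lift f p.2 ↔
      Flat.of (FreeGroup.lift f p.1 * (FreeGroup.lift f p.2)⁻¹) = Flat.of 1 by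
        rw [Flat.of_injective.eq_iff, mul_inv_eq_one]]
    generalize Flat.of (FreeGroup.lift f p.1 * (FreeGroup.lift f p.2)⁻¹) = b
    rcases h1 with h1 | h1
    · rw [h1, Flat.zero_add]
      exact ⟨Or.inl rfl, fun H => (Flat.of_ne_zero _ H.symm).elim, fun H => H.2⟩
    · rw [h1]
      by_cases hb : b = Flat.of 1
      · rw [hb, Flat.add_self]
        simp
      · rw [Flat.add_of_ne (Ne.symm hb)]
        exact ⟨Or.inl rfl, fun H => (Flat.of_ne_zero _ H.symm).elim, fun H => (hb H.1).elim⟩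

theorem exists_identity_of_quasi (m : ℕ) (q : QuasiIdentity) :
    ∃ e : Term × Term, ∀ (G : Type u) [Group G], (∀ x : G, x ^ (m + 1) = 1) →
      (SatisfiesId (Flat G) e ↔ SatisfiesQuasi G q) := by
  obtain ⟨t, ht⟩ := exists_term_of_freeGroup.{u} m (q.conclusion.1 * q.conclusion.2⁻¹)
  obtain ⟨s, hts, hs⟩ := exists_term_of_premises.{u} m t q.premises
  -- The term t has the value of the conclusion's quotient. If the premises fail, both sides are 0;
  -- if they hold, 1 = 1 + t says t = 1. As s contains the variables of t, assignments involving 0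
  -- impose nothing.
  refine ⟨(s, .add s t), fun G _ h => ⟨fun hid f hf => ?_, fun hq => ?_⟩⟩
  · have htf := ht G h f
    have h1 := ((hs G h f (htf ▸ Flat.of_ne_zero _)).2).2 hf
    have h2 := hid (Flat.of ∘ f)
    simp only [Term.eval] at h2
    rw [h1, htf] at h2
    have h3 := Flat.of_injective (Flat.eq_of_add_ne_zero (h2 ▸ Flat.of_ne_zero _))
    rwa [map_mul, map_inv, eq_comm, mul_inv_eq_one] at h3
  · refine satisfiesId_flat (Set.union_eq_self_of_subset_right hts).symm fun f => ?_
    have htf := ht G h f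
    obtain ⟨h1, h2⟩ := hs G h f (htf ▸ Flat.of_ne_zero _)
    simp only [Term.eval]
    rcases h1 with h1 | h1
    · rw [h1, Flat.zero_add]
    · have h3 : t.eval (Flat.of ∘ f) = Flat.of 1 := by
        rw [htf, map_mul, map_inv, hq f (h2.1 h1), mul_inv_cancel]
      rw [h1, h3, Flat.add_self]

/-! ## The correspondence between quasivarieties and varieties -/

theorem satisfiesQuasi_of_subsingleton {G : Type u} [Group G] [Subsingleton G]
    (q : QuasiIdentity) : SatisfiesQuasi G q := fun _ _ => Subsingleton.elim _ _

theorem mem_of_subsingleton (V : GroupQuasivariety.{u}) (G : GrpCat.{u}) [Subsingleton G] :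
    G ∈ V.carrier := by
  obtain ⟨Q, hQ⟩ := V.axiomatized
  rw [hQ]
  exact fun q _ => satisfiesQuasi_of_subsingleton q

theorem flatExt_mem_M_two (G : GrpCat.{u}) [Subsingleton G] :
    flatExt G ∈ (M.{u} 2).carrier :=
  (mem_M_iff 0 _).2 (isM_flat fun _ => Subsingleton.elim _ _)

theorem mem_of_satisfiesId {W : AIVariety.{u}} {A : AISr.{u}}
    (h : ∀ e, (∀ S ∈ W.carrier, SatisfiesId S e) → SatisfiesId A e) : A ∈ W.carrier := by
  obtain ⟨E, hE⟩ := W.equational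
  rw [hE]
  refine fun e he => h e fun S hS => ?_
  rw [hE] at hS
  exact hS e he

theorem satisfiesId_of_forall_maxSubgroup {m : ℕ} {S : Type u} [AISemiring S] (h : IsM m S)
    {e : Term × Term} (he : ∀ a, SatisfiesId (Flat (MaxSubgroup h a)) e) : SatisfiesId S e :=
  satisfiesId_of_separating h.isHom_toFlat (fun _ _ => h.toFlat_jointly_injective) he

/-- Either this flat extension is a homomorphic image of S, or the subgroup is trivial and the flat
extension lies in M_2. -/
theorem flatExt_maxSubgroup_mem {m : ℕ} {W : AIVariety.{u}} (hW : M.{u} 2 ≤ W) {S : AISr.{u}}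
    (h : IsM m S) (hS : S ∈ W.carrier) (a : S) :
    flatExt (GrpCat.of (MaxSubgroup h a)) ∈ W.carrier := by
  rcases h.toFlat_surjective_or a with hs | hs
  · exact mem_of_satisfiesId fun e he =>
      satisfiesId_of_surjective (h.isHom_toFlat a) hs (he S hS)
  · have : Subsingleton (GrpCat.of (MaxSubgroup h a)) := hs
    exact hW (flatExt_mem_M_two _)

/-- The variety generated by the flat extensions of the members of `V`. -/
def flatVariety (V : GroupQuasivariety.{u}) : AIVariety.{u} :=
  .ofIds {e | ∀ G ∈ V.carrier, SatisfiesId (flatExt G) e}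

theorem flatExt_mem_flatVariety {V : GroupQuasivariety.{u}} {G : GrpCat.{u}}
    (hG : G ∈ V.carrier) : flatExt G ∈ (flatVariety V).carrier := fun _ he => he G hG

theorem flatVariety_le_iff {V : GroupQuasivariety.{u}} {W : AIVariety.{u}} :
    flatVariety V ≤ W ↔ ∀ G ∈ V.carrier, flatExt G ∈ W.carrier := by
  refine ⟨fun h G hG => h (flatExt_mem_flatVariety hG), fun h S hS => ?_⟩
  exact mem_of_satisfiesId fun e he => hS e fun G hG => he _ (h G hG)

theorem flatVariety_le_M {m : ℕ} {V : GroupQuasivariety.{u}}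
    (hV : V ≤ BurnsideGroups.{u} (m + 2)) : flatVariety V ≤ M.{u} (m + 2) :=
  flatVariety_le_iff.2 fun G hG =>
    (mem_M_iff m _).2 (isM_flat ((mem_burnsideGroups_iff m G).1 (hV hG)))

theorem M_two_le_flatVariety (V : GroupQuasivariety.{u}) : M.{u} 2 ≤ flatVariety V := by
  intro S hS e he
  have h : IsM 0 S := (mem_M_iff 0 S).1 hS
  refine satisfiesId_of_forall_maxSubgroup h fun a => ?_
  -- With m = 0 the idempotent e_x is x itself, so every maximal subgroup is a single point.
  have : Subsingleton (GrpCat.of (MaxSubgroup h a)) :=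
    ⟨fun x y => MaxSubgroup.ext (x.2.trans y.2.symm)⟩
  exact he _ (mem_of_subsingleton V (GrpCat.of (MaxSubgroup h a)))

/-- The quasi-identities defining V translate into identities valid in all generators, hence in the
flat extension of G. -/
theorem mem_of_flatExt_mem {m : ℕ} {V : GroupQuasivariety.{u}}
    (hV : V ≤ BurnsideGroups.{u} (m + 2)) {G : GrpCat.{u}}
    (hG : flatExt G ∈ (flatVariety V).carrier) : G ∈ V.carrier := by
  have hexp := pow_eq_one_of_isM_flat ((mem_M_iff m _).1 (flatVariety_le_M hV hG))
  obtain ⟨Q, hQ⟩ := V.axiomatized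
  rw [hQ]
  intro q hq
  obtain ⟨e, he⟩ := exists_identity_of_quasi.{u} m q
  refine (he G hexp).1 (hG e fun K hK => ?_)
  refine (he K ((mem_burnsideGroups_iff m K).1 (hV hK))).2 ?_
  rw [hQ] at hK
  exact hK q hq

/-- Birkhoff's theorem is not needed: S embeds in the product of the flat extensions of its maximal
subgroups, and these subgroups belong to V. -/
theorem carrier_flatVariety {m : ℕ} {V : GroupQuasivariety.{u}}
    (hV : V ≤ BurnsideGroups.{u} (m + 2)) :
    (flatVariety V).carrier = HSP (flatExt '' V.carrier) := by
  apply Set.Subset.antisymm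
  · intro S hS
    have h : IsM m S := (mem_M_iff m S).1 (flatVariety_le_M hV hS)
    refine mem_HSP_of_separating (fun a : S => flatExt (GrpCat.of (MaxSubgroup h a)))
      (fun a => ⟨_, mem_of_flatExt_mem hV
        (flatExt_maxSubgroup_mem (M_two_le_flatVariety V) h hS a), rfl⟩)
      h.toFlat h.isHom_toFlat fun x y => h.toFlat_jointly_injective
  · intro S hS e he
    refine satisfiesId_of_mem_HSP ?_ hS
    rintro _ ⟨G, hG, rfl⟩
    exact he G hG

/-- The groups whose flat extensions belong to `W`. -/
def groupQuasivariety (W : AIVariety.{u}) (hW : M.{u} 2 ≤ W) : GroupQuasivariety.{u} where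
  carrier := {G | flatExt G ∈ W.carrier}
  axiomatized := by
    obtain ⟨E, hE⟩ := W.equational
    refine ⟨{q | ∃ e ∈ E, q ∈ quasiOfTerms e.1 e.2 ∪ quasiOfTerms e.2 e.1}, ?_⟩
    -- Here the lower bound M_2 enters: it puts the flat extension of the trivial group into W.
    have hv : ∀ e ∈ E, e.1.vars = e.2.vars := by
      intro e he
      have h1 : flatExt (GrpCat.of PUnit.{u + 1}) ∈ W.carrier := hW (flatExt_mem_M_two _)
      rw [hE] at h1
      exact vars_eq_of_satisfiesId.{u} (h1 e he)
    ext G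
    rw [hE]
    constructor
    · rintro h q ⟨e, he, hq⟩
      exact (satisfiesId_flat_iff (hv e he)).1 (h e he) q hq
    · intro h e he
      exact (satisfiesId_flat_iff (hv e he)).2 fun q hq => h q ⟨e, he, hq⟩

theorem groupQuasivariety_le {m : ℕ} {W : AIVariety.{u}} (hW : M.{u} 2 ≤ W)
    (hW' : W ≤ M.{u} (m + 2)) : groupQuasivariety W hW ≤ BurnsideGroups.{u} (m + 2) :=
  fun G hG => (mem_burnsideGroups_iff m G).2
    (pow_eq_one_of_isM_flat ((mem_M_iff m _).1 (hW' hG)))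

theorem flatVariety_groupQuasivariety {m : ℕ} {W : AIVariety.{u}} (hW : M.{u} 2 ≤ W)
    (hW' : W ≤ M.{u} (m + 2)) : flatVariety (groupQuasivariety W hW) = W := by
  refine le_antisymm (flatVariety_le_iff.2 fun G hG => hG) fun S hS e he => ?_
  have h : IsM m S := (mem_M_iff m S).1 (hW' hS)
  exact satisfiesId_of_forall_maxSubgroup h fun a =>
    he (GrpCat.of (MaxSubgroup h a)) (flatExt_maxSubgroup_mem hW h hS a)

theorem groupQuasivariety_flatVariety {m : ℕ} {V : GroupQuasivariety.{u}}
    (hV : V ≤ BurnsideGroups.{u} (m + 2)) :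
    groupQuasivariety (flatVariety V) (M_two_le_flatVariety V) = V :=
  le_antisymm (fun _ hG => mem_of_flatExt_mem hV hG) fun _ hG => flatExt_mem_flatVariety hG

/-- The isomorphism between the lattices of quasivarieties of groups of exponent dividing
`m + 1` and of varieties between `M 2` and `M (m + 2)`. -/
def flatVarietyIso (m : ℕ) :
    Set.Iic (BurnsideGroups.{u} (m + 2)) ≃o Set.Icc (M.{u} 2) (M.{u} (m + 2)) where
  toFun V := ⟨flatVariety V.1, M_two_le_flatVariety V.1, flatVariety_le_M V.2⟩
  invFun W := ⟨groupQuasivariety W.1 W.2.1, groupQuasivariety_le W.2.1 W.2.2⟩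
  left_inv V := Subtype.ext (groupQuasivariety_flatVariety V.2)
  right_inv W := Subtype.ext (flatVariety_groupQuasivariety W.2.1 W.2.2)
  map_rel_iff' {_ V'} :=
    ⟨fun h _ hG => mem_of_flatExt_mem V'.2 (h (flatExt_mem_flatVariety hG)),
      fun h => flatVariety_le_iff.2 fun _ hG => flatExt_mem_flatVariety (h hG)⟩

theorem M_le_Sr (n : ℕ) : M.{u} n ≤ Sr.{u} n := by
  rintro S hS e rfl
  exact hS _ (Set.mem_insert _ _)

/-- The inclusion of the interval `[M 2, M n]` in the lattice of subvarieties of `Sr n`. -/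
def intervalInclusion (n : ℕ) :
    LatticeHom (Set.Icc (M.{u} 2) (M.{u} n)) (Set.Iic (Sr.{u} n)) where
  toFun W := ⟨W.1, W.2.2.trans (M_le_Sr n)⟩
  -- Binary joins in the interval and in the down-set are both the ambient joins.
  map_sup' _ _ := rfl
  map_inf' _ _ := rfl

end BurnsideAI

theorem proposition3p1 (n : ℕ) (hn : 2 ≤ n) :
    (∃ ψ : LatticeHom (Set.Iic (BurnsideAI.BurnsideGroups.{u} n))
          (Set.Icc (BurnsideAI.M.{u} 2) (BurnsideAI.M.{u} n)),
        (∀ V : Set.Iic (BurnsideAI.BurnsideGroups.{u} n),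
          (ψ V : BurnsideAI.AIVariety.{u}).carrier =
            BurnsideAI.HSP (BurnsideAI.flatExt '' (V : BurnsideAI.GroupQuasivariety.{u}).carrier)) ∧
        Function.Bijective ψ) ∧
    ∃ φ : LatticeHom (Set.Iic (BurnsideAI.BurnsideGroups.{u} n))
        (Set.Iic (BurnsideAI.Sr.{u} n)),
      Function.Injective φ := by
  obtain ⟨m, rfl⟩ := Nat.exists_eq_add_of_le' hn
  let I := BurnsideAI.flatVarietyIso.{u} m
  let ψ : LatticeHom (Set.Iic (BurnsideAI.BurnsideGroups.{u} (m + 2)))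
      (Set.Icc (BurnsideAI.M.{u} 2) (BurnsideAI.M.{u} (m + 2))) :=
    { toFun := I
      map_sup' := map_sup I
      map_inf' := map_inf I }
  refine ⟨⟨ψ, fun V => BurnsideAI.carrier_flatVariety V.2, I.bijective⟩,
    (BurnsideAI.intervalInclusion.{u} (m + 2)).comp ψ, fun V V' h => I.injective ?_⟩
  exact Subtype.ext (congrArg (fun W => W.1) h)
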